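/- Let $(Y_i)_{i\ge 1}$ be i.i.d. real random variables with density $f:\mathbb R\to[0,\infty)$ and distribution function $F$, and let $D=\{y\in\mathbb R: f(y)>0\}$. For each sample size $n\ge 1$ let $K=K_n\ge 1$ be an integer and let $\infty=t_0>t_1>\dots>t_K$ be (deterministic) thresholds, possibly depending on $n$, with bins $I_k=[t_k,t_{k-1})$, $1\le k\le K$. Assume that (i) $f$ is Lipschitz continuous: $|f(y_1)-f(y_2)|\le L|y_1-y_2|$ for all $y_1,y_2\in\mathbb R$, for some $L>0$; (ii) there are constants $c_1,c_2>0$ and $0<r_2\le r_1<1/4$ such that for all $n$ $$c_1n^{-r_1}\le\min_{2\le k\le K}(t_{k-1}-t_k)\le\max_{2\le k\le K}(t_{k-1}-t_k)\le c_2n^{-r_2};$$ (iii) $\limsup_{n\to\infty}t_K\le\inf D$ and $\liminf_{n\to\infty}t_1\ge\sup D$ (in the extended reals). Let $Y_{(1)}\ge\dots\ge Y_{(n)}$ be the order statistics of $Y_1,\dots,Y_n$, let $S_m=\sum_{i=1}^mY_{(i)}$ and $n_k=\#\{i:Y_{(i)}\ge t_k\}$ (with $S_0=n_0=0$), and put $\hat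 q_k=(n_k-n_{k-1})/n$ and $\hat y_k=(S_{n_k}-S_{n_{k-1}})/(n_k-n_{k-1})$ (with $\hat q_k\hat y_k=0$ if the bin is empty). Let $\hat f$ be the maximum entropy density of this tabulation, that is, the solution (unique up to null sets; it exists almost surely) of the problem of minimizing $\int_I g(y)\log g(y)\,dy$ over the nonnegative integrable functions $g$ on $I=[t_K,\infty)$ with $$\int_{I_k}g(y)\,dy=\hat q_k,\qquad\int_{I_k}y\,g(y)\,dy=\hat q_k\hat y_k\qquad(1\le k\le K),$$ extended by $0$ outside $I$, and let $\hat F(y)=\int_{-\infty}^y\hat f(z)\,dz$. If $\inf D>-\infty$, then for every compact set $C\subset D$, almost surely, $$\sup_{y\in C}|\hat F(y)-F(y)|\to 0\qquad\text{as }n\to\infty .$$ -/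

import Mathlib

open MeasureTheory ProbabilityTheory Filter Topology Set

noncomputable section

namespace TabulatedME

/-! Tabulated data. A threshold sequence is `t : ℕ → ℝ`, of which only the values
`t 1 > t 2 > ⋯ > t K` matter; the convention `t_0 = ∞` is built into `thr`. -/

/-- The thresholds `∞ = t_0 > t_1 > ⋯ > t_K` as extended reals. -/
def thr (t : ℕ → ℝ) (k : ℕ) : EReal := if k = 0 then ⊤ else (t k : EReal)

/-- The `k`-th bin from the top, `I_k = [t_k, t_{k-1})`, for `k ≥ 1`. -/
def bin (t : ℕ → ℝ) (k : ℕ) : Set ℝ :=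
  {y : ℝ | thr t k ≤ (y : EReal) ∧ (y : EReal) < thr t (k - 1)}

/-- The order statistics in decreasing order, `Y_(1) ≥ Y_(2) ≥ ⋯ ≥ Y_(n)`
(here indexed from `0`). -/
def orderStat {n : ℕ} (x : Fin n → ℝ) (i : Fin n) : ℝ := x (Tuple.sort x i.rev)

/-- `S_m`, the sum of the `m` largest observations. -/
def topSum {n : ℕ} (x : Fin n → ℝ) (m : ℕ) : ℝ :=
  ∑ i : Fin n with i.val < m, orderStat x i

/-- `n_k`, the number of order statistics that are at least `t_k` (so `n_0 = 0`). -/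
def topCount (t : ℕ → ℝ) {n : ℕ} (x : Fin n → ℝ) (k : ℕ) : ℕ :=
  (Finset.univ.filter fun i : Fin n => thr t k ≤ (orderStat x i : EReal)).card

/-- The empirical bin probability `(n_k - n_{k-1}) / n`. -/
def qHat (t : ℕ → ℝ) {n : ℕ} (x : Fin n → ℝ) (k : ℕ) : ℝ :=
  ((topCount t x k : ℝ) - topCount t x (k - 1)) / n

/-- The empirical bin mean `(S_{n_k} - S_{n_{k-1}}) / (n_k - n_{k-1})`. For an empty bin its value
is irrelevant, as it only enters through its product with `qHat`, which is then `0`. -/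
def yHat (t : ℕ → ℝ) {n : ℕ} (x : Fin n → ℝ) (k : ℕ) : ℝ :=
  (topSum x (topCount t x k) - topSum x (topCount t x (k - 1))) /
    ((topCount t x k : ℝ) - topCount t x (k - 1))

/-- `g` is a nonnegative integrable function on `I = [t_K, ∞)`, extended by zero to `ℝ`, that
satisfies the moment conditions `∫_{I_k} g = q_k` and `∫_{I_k} y g(y) dy = q_k y_k` for
`k = 1, …, K`. -/
structure Feasible (K : ℕ) (t q m : ℕ → ℝ) (g : ℝ → ℝ) : Prop where
  nonneg : ∀ y, 0 ≤ g y
  eq_zero : ∀ y, y < t K → g y = 0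
  integrable : Integrable g
  mass : ∀ k, 1 ≤ k → k ≤ K → ∫ y in bin t k, g y = q k
  integrable_mean : ∀ k, 1 ≤ k → k ≤ K → IntegrableOn (fun y => y * g y) (bin t k)
  mean : ∀ k, 1 ≤ k → k ≤ K → ∫ y in bin t k, y * g y = q k * m k

/-- `g` solves the maximum entropy problem: it minimizes `∫_I g log g` over all feasible
functions. For feasible `h` the negative part of `h log h` is integrable, so `∫_I h log h` is
`+∞` exactly if `h log h` is not integrable on `I`; such `h` are not competitors. -/
structure IsMESolution (K : ℕ) (t q m : ℕ → ℝ) (g : ℝ → ℝ) : Prop where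
  feasible : Feasible K t q m g
  integrable : IntegrableOn (fun y => g y * Real.log (g y)) (Ici (t K))
  minimal : ∀ h : ℝ → ℝ, Feasible K t q m h →
    IntegrableOn (fun y => h y * Real.log (h y)) (Ici (t K)) →
      ∫ y in Ici (t K), g y * Real.log (g y) ≤ ∫ y in Ici (t K), h y * Real.log (h y)

open Classical in
/-- The maximum entropy density: the solution of the maximum entropy problem
(unique up to null sets), and `0` if there is none. -/
def meDensity (K : ℕ) (t q m : ℕ → ℝ) : ℝ → ℝ :=
  if h : ∃ g, IsMESolution K t q m g then h.choose else 0

/-- The estimated density from the tabulation of the sample `x` with thresholds `t`. -/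
def fHat (K : ℕ) (t : ℕ → ℝ) {n : ℕ} (x : Fin n → ℝ) : ℝ → ℝ :=
  meDensity K t (qHat t x) (yHat t x)

/-- The estimated distribution function `y ↦ ∫_{-∞}^y f̂`. -/
def FHat (K : ℕ) (t : ℕ → ℝ) {n : ℕ} (x : Fin n → ℝ) (y : ℝ) : ℝ :=
  ∫ z in Iic y, fHat K t x z

/-- The domain `D = {y : f y > 0}` of a density. -/
def domain (f : ℝ → ℝ) : Set ℝ := {y | 0 < f y}

/-- Infimum of a set of reals, as an extended real. -/
def einf (D : Set ℝ) : EReal := ⨅ y ∈ D, (y : EReal)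

/-- Supremum of a set of reals, as an extended real. -/
def esup (D : Set ℝ) : EReal := ⨆ y ∈ D, (y : EReal)

/-- The standing assumption: an i.i.d. sample with a Lipschitz density `f`, and, for each sample
size `n ≥ 1`, a number `K n ≥ 1` of bins with thresholds `t n 1 > ⋯ > t n (K n)` such that all
bounded bins have lengths between `c₁ n^(-r₁)` and `c₂ n^(-r₂)` and the bounded bins
asymptotically cover the domain of `f`. -/
structure Assumption {Ω : Type*} [MeasurableSpace Ω] (P : Measure Ω) (Y : ℕ → Ω → ℝ)
    (f : ℝ → ℝ) (K : ℕ → ℕ) (t : ℕ → ℕ → ℝ) : Prop where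
  measurable : ∀ i, Measurable (Y i)
  indep : iIndepFun Y P
  density : ∀ i, P.map (Y i) = volume.withDensity fun y => ENNReal.ofReal (f y)
  nonneg : ∀ y, 0 ≤ f y
  lipschitz : ∃ L : ℝ, 0 < L ∧ ∀ y₁ y₂, |f y₁ - f y₂| ≤ L * |y₁ - y₂|
  bins_pos : ∀ n, 1 ≤ n → 1 ≤ K n
  thr_anti : ∀ n, 1 ≤ n → ∀ k, 2 ≤ k → k ≤ K n → t n k < t n (k - 1)
  bin_length : ∃ c₁ c₂ r₁ r₂ : ℝ, 0 < c₁ ∧ 0 < c₂ ∧ 0 < r₂ ∧ r₂ ≤ r₁ ∧ r₁ < 1 / 4 ∧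
    ∀ n, 1 ≤ n → ∀ k, 2 ≤ k → k ≤ K n →
      c₁ * (n : ℝ) ^ (-r₁) ≤ t n (k - 1) - t n k ∧ t n (k - 1) - t n k ≤ c₂ * (n : ℝ) ^ (-r₂)
  cover_inf : limsup (fun n => (t n (K n) : EReal)) atTop ≤ einf (domain f)
  cover_sup : esup (domain f) ≤ liminf (fun n => (t n 1 : EReal)) atTop

end TabulatedME

end

namespace TabulatedME

/-! ### Bins -/

/-! Convergence comes from the mass constraints. They telescope, so at every threshold the tail of
`fHat` equals the empirical tail (`setIntegral_Ici_fHat`). Between thresholds `FHat` is monotone and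
the bounded bins shrink, so `FHat` at `y` is squeezed between empirical values at fixed points
slightly left and right of `y` (`le_FHat`, `FHat_le`). The errors left are the sample mass below
`t_K` and the mass in the top bin; the covering conditions make both negligible. The strong law at
rational points then gives pointwise convergence on a single almost sure event
(`Assumption.tendsto_FHat`), and monotonicity with continuity of the limit makes it uniform on
compact sets.

The constraints are available only if a solution exists, since `meDensity` is `0` otherwise. Almost
surely no observation hits a threshold, so each nonempty bin has its mean in its interior
(`yHat_mem_interior`). An exponential density then matches mass and mean on each such bin, and the
Gibbs inequality shows that the pieces together are optimal (`exists_isMESolution`). -/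

lemma bin_one (t : ℕ → ℝ) : bin t 1 = Ici (t 1) := by
  ext y; simp [bin, thr]

lemma bin_succ (t : ℕ → ℝ) {k : ℕ} (hk : 1 ≤ k) : bin t (k + 1) = Ico (t (k + 1)) (t k) := by
  ext y
  have : k ≠ 0 := by omega
  simp [bin, thr, this]

lemma measurableSet_bin (t : ℕ → ℝ) {k : ℕ} (hk : 1 ≤ k) : MeasurableSet (bin t k) := by
  obtain rfl | h := hk.eq_or_lt
  · rw [bin_one]; exact measurableSet_Ici
  · obtain ⟨j, rfl⟩ : ∃ j, k = j + 1 := ⟨k - 1, by omega⟩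
    rw [bin_succ t (by omega)]; exact measurableSet_Ico

lemma thr_le_thr {K : ℕ} {t : ℕ → ℝ} (ht : ∀ k, 2 ≤ k → k ≤ K → t k < t (k - 1)) {j k : ℕ}
    (hjk : j ≤ k) (hk : k ≤ K) : thr t k ≤ thr t j := by
  induction k, hjk using Nat.le_induction with
  | base => exact le_rfl
  | succ k hjk ih =>
    refine le_trans ?_ (ih (by omega))
    obtain rfl | h := Nat.eq_zero_or_pos k
    · simp [thr]
    · have := ht (k + 1) (by omega) hk
      simp only [Nat.add_sub_cancel] at this
      simp [thr, h.ne', this.le]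

lemma antitone_thresholds {K : ℕ} {t : ℕ → ℝ} (ht : ∀ k, 2 ≤ k → k ≤ K → t k < t (k - 1))
    {j k : ℕ} (hj : 1 ≤ j) (hjk : j ≤ k) (hk : k ≤ K) : t k ≤ t j := by
  have := thr_le_thr ht hjk hk
  have h1 : j ≠ 0 := by omega
  have h2 : k ≠ 0 := by omega
  simpa [thr, h1, h2] using this

lemma notMem_bin_of_lt {K : ℕ} {t : ℕ → ℝ} (ht : ∀ k, 2 ≤ k → k ≤ K → t k < t (k - 1))
    {j k : ℕ} (hjk : j < k) (hk : k ≤ K) {y : ℝ} (hy : y ∈ bin t k) : y ∉ bin t j := fun h =>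
  absurd (h.1.trans_lt (hy.2.trans_le (thr_le_thr ht (show j ≤ k - 1 by omega) (by omega))))
    (lt_irrefl _)

lemma eq_of_mem_bin {K : ℕ} {t : ℕ → ℝ} (ht : ∀ k, 2 ≤ k → k ≤ K → t k < t (k - 1))
    {j k : ℕ} (hj : j ≤ K) (hk : k ≤ K) {y : ℝ} (hyj : y ∈ bin t j) (hyk : y ∈ bin t k) :
    j = k := by
  rcases lt_trichotomy j k with h | h | h
  · exact absurd hyj (notMem_bin_of_lt ht h hk hyk)
  · exact h
  · exact absurd hyk (notMem_bin_of_lt ht h hj hyj)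

lemma bin_subset_Ici {K : ℕ} {t : ℕ → ℝ} (ht : ∀ k, 2 ≤ k → k ≤ K → t k < t (k - 1))
    {k : ℕ} (hk : 1 ≤ k) (hkK : k ≤ K) : bin t k ⊆ Ici (t K) := fun y hy => by
  have h1 : k ≠ 0 := by omega
  have := hy.1
  simp only [thr, h1, if_false, EReal.coe_le_coe_iff] at this
  exact (antitone_thresholds ht hk hkK le_rfl).trans this

/-- Every real that is at least `t_K` lies in one of the bins. -/
lemma exists_mem_bin {K : ℕ} {t : ℕ → ℝ} (hK : 1 ≤ K) {y : ℝ} (hy : t K ≤ y) :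
    ∃ k, 1 ≤ k ∧ k ≤ K ∧ y ∈ bin t k := by
  induction K, hK using Nat.le_induction with
  | base => exact ⟨1, le_rfl, le_rfl, by rwa [bin_one]⟩
  | succ K hK ih =>
    by_cases h : t K ≤ y
    · obtain ⟨k, h1, h2, h3⟩ := ih h
      exact ⟨k, h1, by omega, h3⟩
    · exact ⟨K + 1, by omega, le_rfl, by rw [bin_succ t hK]; exact ⟨hy, not_le.1 h⟩⟩

lemma setIntegral_Ici_eq_sum_bin {K : ℕ} {t : ℕ → ℝ}
    (ht : ∀ k, 2 ≤ k → k ≤ K → t k < t (k - 1)) {k : ℕ} (hk : 1 ≤ k) (hkK : k ≤ K) {φ : ℝ → ℝ}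
    (hφ : IntegrableOn φ (Ici (t k))) :
    ∫ y in Ici (t k), φ y = ∑ j ∈ Finset.Icc 1 k, ∫ y in bin t j, φ y := by
  induction k, hk using Nat.le_induction with
  | base => simp [bin_one]
  | succ k hk ih =>
    have hlt : t (k + 1) < t k := ht (k + 1) (by omega) hkK
    have hu : Ici (t (k + 1)) = Ico (t (k + 1)) (t k) ∪ Ici (t k) :=
      (Ico_union_Ici_eq_Ici hlt.le).symm
    have hd : Disjoint (Ico (t (k + 1)) (t k)) (Ici (t k)) :=
      Set.disjoint_left.2 fun y h1 h2 => absurd h1.2 (not_lt.2 h2)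
    rw [Finset.sum_Icc_succ_top (by omega), ← ih (by omega) (hφ.mono_set (Ici_subset_Ici.2 hlt.le)),
      hu, setIntegral_union hd measurableSet_Ici (hφ.mono_set (by rw [hu]; exact subset_union_left))
        (hφ.mono_set (by rw [hu]; exact subset_union_right)), bin_succ t hk, add_comm]

/-! ### Exponential densities with a given mass and mean -/

/-- `b ↦ ∫_{-p}^r w exp (b w) dw` is positive for `b = 1/r`. -/
lemma intervalIntegral_mul_exp_pos {p r : ℝ} (hp : 0 < p) (hr : 0 < r) :
    0 < ∫ w in (-p)..r, w * Real.exp (r⁻¹ * w) := by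
  -- For the rate `1/r` this antiderivative vanishes at `w = r`, so only the endpoint `-p`
  -- contributes, with a visible sign.
  have hd : ∀ w ∈ uIcc (-p) r, HasDerivAt (fun w => Real.exp (r⁻¹ * w) * (w * r - r ^ 2))
      (w * Real.exp (r⁻¹ * w)) w := fun w _ => by
    have h1 : HasDerivAt (fun w => r⁻¹ * w) r⁻¹ w := by
      simpa using (hasDerivAt_id w).const_mul r⁻¹
    have h2 : HasDerivAt (fun w => w * r - r ^ 2) r w := by
      simpa using ((hasDerivAt_id w).mul_const r).sub_const (r ^ 2)
    refine (h1.exp.mul h2).congr_deriv ?_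
    field_simp
    ring
  rw [intervalIntegral.integral_eq_sub_of_hasDerivAt hd
    (Continuous.intervalIntegrable (by fun_prop) _ _)]
  have h3 := Real.exp_pos (r⁻¹ * -p)
  have : 0 < Real.exp (r⁻¹ * -p) * (p * r + r ^ 2) := by positivity
  nlinarith

/-- Intermediate value theorem in `b`: the integral is positive at `1/r` and, by the reflection `w ↦
-w`, negative at `-1/p`. -/
lemma exists_intervalIntegral_mul_exp_eq_zero {p r : ℝ} (hp : 0 < p) (hr : 0 < r) :
    ∃ b : ℝ, ∫ w in (-p)..r, w * Real.exp (b * w) = 0 := by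
  have hc : Continuous fun b : ℝ => ∫ w in (-p)..r, w * Real.exp (b * w) :=
    intervalIntegral.continuous_parametric_intervalIntegral_of_continuous' (by fun_prop) _ _
  have h1 := intervalIntegral_mul_exp_pos hp hr
  have h2 := intervalIntegral_mul_exp_pos hr hp
  have h3 : ∫ w in (-p)..r, w * Real.exp (-p⁻¹ * w) < 0 := by
    have := intervalIntegral.integral_comp_neg (a := -p) (b := r)
      (fun w => w * Real.exp (p⁻¹ * w))
    simp only [neg_neg] at this
    rw [← this] at h2
    have h4 : ∫ w in (-p)..r, -w * Real.exp (p⁻¹ * -w)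
        = -∫ w in (-p)..r, w * Real.exp (-p⁻¹ * w) := by
      rw [← intervalIntegral.integral_neg]
      congr 1; ext w; ring_nf
    linarith
  obtain ⟨b, hb⟩ := mem_range_of_exists_le_of_exists_ge hc ⟨_, h3.le⟩ ⟨_, h1.le⟩
  exact ⟨b, hb⟩

/-- `y ↦ exp (c + b y)` has mass `q` and first moment `q m` on `B`. -/
structure HasExpMoments (B : Set ℝ) (q m c b : ℝ) : Prop where
  integrable : IntegrableOn (fun y => Real.exp (c + b * y)) B
  integrable_mean : IntegrableOn (fun y => y * Real.exp (c + b * y)) B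
  mass : ∫ y in B, Real.exp (c + b * y) = q
  mean : ∫ y in B, y * Real.exp (c + b * y) = q * m

/-- Centring at `m` turns the mean condition into a vanishing first moment, which fixes the tilt
`b`; then `c` normalizes the mass. -/
lemma exists_hasExpMoments_Ico {s u m q : ℝ} (hs : s < m) (hu : m < u) (hq : 0 < q) :
    ∃ c b, HasExpMoments (Ico s u) q m c b := by
  obtain ⟨b, hb⟩ := exists_intervalIntegral_mul_exp_eq_zero (sub_pos.2 hs) (sub_pos.2 hu)
  have hb' : ∫ y in s..u, (y - m) * Real.exp (b * (y - m)) = 0 := by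
    rw [intervalIntegral.integral_comp_sub_right (fun w => w * Real.exp (b * w)), ← hb, neg_sub]
  set Z : ℝ := ∫ y in s..u, Real.exp (b * (y - m)) with hZ
  have hZpos : 0 < Z := intervalIntegral.intervalIntegral_pos_of_pos
    (Continuous.intervalIntegrable (by fun_prop) _ _) (fun _ => Real.exp_pos _) (hs.trans hu)
  have key : ∀ y, Real.exp (Real.log (q / Z) - b * m + b * y) = q / Z * Real.exp (b * (y - m)) :=
    fun y => by
      rw [show Real.log (q / Z) - b * m + b * y = Real.log (q / Z) + b * (y - m) by ring,
        Real.exp_add, Real.exp_log (by positivity)]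
  have hi : ∀ φ : ℝ → ℝ, ∫ y in Ico s u, φ y = ∫ y in s..u, φ y := fun φ => by
    rw [intervalIntegral.integral_of_le (hs.trans hu).le, integral_Ico_eq_integral_Ioc]
  refine ⟨Real.log (q / Z) - b * m, b, ?_, ?_, ?_, ?_⟩
  · exact (Continuous.integrableOn_Icc (by fun_prop)).mono_set Ico_subset_Icc_self
  · exact (Continuous.integrableOn_Icc (by fun_prop)).mono_set Ico_subset_Icc_self
  · simp only [hi, key]
    rw [intervalIntegral.integral_const_mul, ← hZ]
    field_simp
  · simp only [hi, key]
    have : ∀ y, y * (q / Z * Real.exp (b * (y - m)))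
        = q / Z * ((y - m) * Real.exp (b * (y - m))) + q / Z * m * Real.exp (b * (y - m)) :=
      fun y => by ring
    simp only [this]
    rw [intervalIntegral.integral_add (Continuous.intervalIntegrable (by fun_prop) _ _)
      (Continuous.intervalIntegrable (by fun_prop) _ _), intervalIntegral.integral_const_mul,
      intervalIntegral.integral_const_mul, hb', ← hZ]
    field_simp
    ring

/-- The exponential law started at `s` with mean excess `θ = m - s`, scaled to mass `q`, works; both
moments have explicit antiderivatives. -/
lemma exists_hasExpMoments_Ici {s m q : ℝ} (hs : s < m) (hq : 0 < q) :
    ∃ c b, HasExpMoments (Ici s) q m c b := by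
  set θ := m - s with hθ
  have hθ0 : 0 < θ := sub_pos.2 hs
  have key : ∀ y, Real.exp (Real.log (q / θ) + s / θ + -(1 / θ) * y)
      = q / θ * Real.exp (-(y - s) / θ) := fun y => by
    rw [show Real.log (q / θ) + s / θ + -(1 / θ) * y = Real.log (q / θ) + -(y - s) / θ by ring,
      Real.exp_add, Real.exp_log (by positivity)]
  have hE : ∀ y, HasDerivAt (fun y => Real.exp (-(y - s) / θ)) (-Real.exp (-(y - s) / θ) / θ) y :=
    fun y => by
      have : HasDerivAt (fun y => -(y - s) / θ) (-1 / θ) y :=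
        (((hasDerivAt_id y).sub_const s).neg).div_const θ
      refine this.exp.congr_deriv ?_
      ring
  have hlin : Tendsto (fun y => (y - s) / θ) atTop atTop :=
    (tendsto_atTop_add_const_right _ (-s) tendsto_id).atTop_div_const hθ0
  have hT0 : Tendsto (fun y => Real.exp (-(y - s) / θ)) atTop (𝓝 0) := by
    have := Real.tendsto_exp_neg_atTop_nhds_zero.comp hlin
    refine this.congr fun y => ?_
    simp only [Function.comp_apply, neg_div]
  have hT1 : Tendsto (fun y => (y - s) / θ * Real.exp (-(y - s) / θ)) atTop (𝓝 0) := by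
    have := (Real.tendsto_pow_mul_exp_neg_atTop_nhds_zero 1).comp hlin
    refine this.congr fun y => ?_
    simp only [Function.comp_apply, pow_one, neg_div]
  have hd0 : ∀ y ∈ Ici s, HasDerivAt (fun y => -(q * Real.exp (-(y - s) / θ)))
      (q / θ * Real.exp (-(y - s) / θ)) y := fun y _ => by
    refine ((hE y).const_mul q).neg.congr_deriv ?_
    ring
  have hd1 : ∀ y ∈ Ici s, HasDerivAt
      (fun y => -(q * θ * ((y - s) / θ * Real.exp (-(y - s) / θ)) + q * θ * Real.exp (-(y - s) / θ)))
      ((y - s) * (q / θ * Real.exp (-(y - s) / θ))) y := fun y _ => by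
    have h1 : HasDerivAt (fun y => (y - s) / θ) (1 / θ) y :=
      ((hasDerivAt_id y).sub_const s).div_const θ
    refine ((((h1.mul (hE y)).const_mul (q * θ)).add ((hE y).const_mul (q * θ))).neg).congr_deriv ?_
    field_simp
    ring
  have hl0 : Tendsto (fun y => -(q * Real.exp (-(y - s) / θ))) atTop (𝓝 0) := by
    simpa using (hT0.const_mul q).neg
  have hl1 : Tendsto (fun y => -(q * θ * ((y - s) / θ * Real.exp (-(y - s) / θ))
      + q * θ * Real.exp (-(y - s) / θ))) atTop (𝓝 0) := by
    simpa using ((hT1.const_mul (q * θ)).add (hT0.const_mul (q * θ))).neg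
  have hp0 : ∀ y ∈ Ioi s, 0 ≤ q / θ * Real.exp (-(y - s) / θ) := fun y _ => by positivity
  have hp1 : ∀ y ∈ Ioi s, 0 ≤ (y - s) * (q / θ * Real.exp (-(y - s) / θ)) := fun y hy => by
    have : 0 < y - s := sub_pos.2 hy
    positivity
  have hi0 := integrableOn_Ioi_deriv_of_nonneg' hd0 hp0 hl0
  have hi1 := integrableOn_Ioi_deriv_of_nonneg' hd1 hp1 hl1
  have hv0 := integral_Ioi_of_hasDerivAt_of_nonneg' hd0 hp0 hl0
  have hv1 := integral_Ioi_of_hasDerivAt_of_nonneg' hd1 hp1 hl1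
  have hsplit : ∀ y, y * (q / θ * Real.exp (-(y - s) / θ))
      = (y - s) * (q / θ * Real.exp (-(y - s) / θ)) + s * (q / θ * Real.exp (-(y - s) / θ)) :=
    fun y => by ring
  refine ⟨Real.log (q / θ) + s / θ, -(1 / θ), ?_, ?_, ?_, ?_⟩
  · simp only [key]
    rwa [integrableOn_Ici_iff_integrableOn_Ioi]
  · simp only [key, hsplit]
    rw [integrableOn_Ici_iff_integrableOn_Ioi]
    exact hi1.add (hi0.const_mul s)
  · simp only [key]
    rw [integral_Ici_eq_integral_Ioi, hv0]
    simp
  · simp only [key, hsplit]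
    rw [integral_Ici_eq_integral_Ioi, integral_add hi1 (hi0.const_mul s), integral_const_mul, hv0,
      hv1]
    simp [hθ]
    ring

/-! ### The maximum entropy problem -/

/-- The Gibbs inequality: an exponential density minimizes `∫ h log h` among the nonnegative
functions with the same mass and mean. -/
lemma HasExpMoments.le_integral_mul_log {B : Set ℝ} {q m c b : ℝ} (hg : HasExpMoments B q m c b)
    {h : ℝ → ℝ} (h0 : ∀ y, 0 ≤ h y) (hi : IntegrableOn h B)
    (hi1 : IntegrableOn (fun y => y * h y) B) (hq : ∫ y in B, h y = q)
    (hm : ∫ y in B, y * h y = q * m) (hl : IntegrableOn (fun y => h y * Real.log (h y)) B) :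
    ∫ y in B, Real.exp (c + b * y) * Real.log (Real.exp (c + b * y))
      ≤ ∫ y in B, h y * Real.log (h y) := by
  have h1 : ∫ y in B, Real.exp (c + b * y) * Real.log (Real.exp (c + b * y))
      = c * q + b * (q * m) := by
    rw [← hg.mean, ← hg.mass, ← integral_const_mul, ← integral_const_mul,
      ← integral_add (hg.integrable.const_mul c) (hg.integrable_mean.const_mul b)]
    congr 1; ext y; rw [Real.log_exp]; ring
  have hsum : IntegrableOn (fun y => (1 + c) * h y + b * (y * h y)) B :=
    (hi.const_mul (1 + c)).add (hi1.const_mul b)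
  -- With `ℓ = c + b y`, the integrand is the tangent lower bound `(1 + ℓ) h - exp ℓ` for `h log h`.
  -- Its integral depends on `h` only through the prescribed moments.
  have h2 : ∫ y in B, ((1 + c) * h y + b * (y * h y) - Real.exp (c + b * y))
      = c * q + b * (q * m) := by
    rw [integral_sub hsum hg.integrable,
      integral_add (hi.const_mul (1 + c)) (hi1.const_mul b), integral_const_mul,
      integral_const_mul, hq, hm, hg.mass]
    ring
  rw [h1, ← h2]
  refine integral_mono (hsum.sub hg.integrable) hl fun y => ?_
  simp only
  obtain hy | hy := (h0 y).eq_or_lt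
  · rw [← hy]; simp [(Real.exp_pos _).le]
  -- The tangent bound is `x + 1 ≤ exp x` at `x = ℓ - log h`, multiplied by `h`.
  · have h3 := Real.add_one_le_exp (c + b * y - Real.log (h y))
    rw [Real.exp_sub, Real.exp_log hy, le_div_iff₀ hy] at h3
    nlinarith

/-- The maximum entropy problem has a solution if each bin mean lies in the interior of its bin. -/
theorem exists_isMESolution {K : ℕ} {t q m : ℕ → ℝ} (hK : 1 ≤ K)
    (ht : ∀ k, 2 ≤ k → k ≤ K → t k < t (k - 1)) (hq : ∀ k, 1 ≤ k → k ≤ K → 0 ≤ q k)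
    (hlow : ∀ k, 1 ≤ k → k ≤ K → 0 < q k → t k < m k)
    (hupp : ∀ k, 2 ≤ k → k ≤ K → 0 < q k → m k < t (k - 1)) :
    ∃ g, IsMESolution K t q m g := by
  have hex : ∀ k, ∃ c b, 1 ≤ k → k ≤ K → 0 < q k → HasExpMoments (bin t k) (q k) (m k) c b := by
    intro k
    by_cases h : 1 ≤ k ∧ k ≤ K ∧ 0 < q k
    · obtain ⟨h1, h2, h3⟩ := h
      have : ∃ c b, HasExpMoments (bin t k) (q k) (m k) c b := by
        obtain rfl | h4 := h1.eq_or_lt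
        · rw [bin_one]; exact exists_hasExpMoments_Ici (hlow _ h1 h2 h3) h3
        · obtain ⟨j, rfl⟩ : ∃ j, k = j + 1 := ⟨k - 1, by omega⟩
          rw [bin_succ t (by omega)]
          exact exists_hasExpMoments_Ico (hlow _ h1 h2 h3) (hupp _ h4 h2 h3) h3
      obtain ⟨c, b, h⟩ := this
      exact ⟨c, b, fun _ _ _ => h⟩
    · exact ⟨0, 0, fun h1 h2 h3 => absurd ⟨h1, h2, h3⟩ h⟩
  choose c b hcb using hex
  -- On bins of mass zero the density must vanish, and the chosen coefficients there are dummies.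
  set G : ℕ → ℝ → ℝ := fun k y => if 0 < q k then Real.exp (c k + b k * y) else 0 with hG
  have hG0 : ∀ k y, 0 ≤ G k y := fun k y => by
    simp only [hG]; split_ifs <;> positivity
  set g : ℝ → ℝ := fun y => ∑ k ∈ Finset.Icc 1 K, (bin t k).indicator (G k) y with hg
  have hgbin : ∀ k, 1 ≤ k → k ≤ K → ∀ y ∈ bin t k, g y = G k y := by
    intro k h1 h2 y hy
    simp only [hg]
    rw [Finset.sum_eq_single_of_mem k (Finset.mem_Icc.2 ⟨h1, h2⟩), indicator_of_mem hy]
    intro j hj hjk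
    refine indicator_of_notMem (fun h => hjk ?_) _
    exact eq_of_mem_bin ht (Finset.mem_Icc.1 hj).2 h2 h hy
  have hGi : ∀ k, 1 ≤ k → k ≤ K → IntegrableOn (G k) (bin t k) := by
    intro k h1 h2
    simp only [hG]
    split_ifs with h
    · exact (hcb k h1 h2 h).integrable
    · exact integrableOn_zero
  have hGm : ∀ k, 1 ≤ k → k ≤ K → IntegrableOn (fun y => y * G k y) (bin t k) := by
    intro k h1 h2
    simp only [hG]
    split_ifs with h
    · exact (hcb k h1 h2 h).integrable_mean
    · simp
  have hGl : ∀ k, 1 ≤ k → k ≤ K →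
      IntegrableOn (fun y => G k y * Real.log (G k y)) (bin t k) := by
    intro k h1 h2
    simp only [hG]
    split_ifs with h
    · refine (((hcb k h1 h2 h).integrable.const_mul (c k)).add
        ((hcb k h1 h2 h).integrable_mean.const_mul (b k))).congr (ae_of_all _ fun y => ?_)
      simp only [Pi.add_apply, Real.log_exp]
      ring
    · simp
  have hgl : IntegrableOn (fun y => g y * Real.log (g y)) (Ici (t K)) := by
    have hsub : Ici (t K) ⊆ ⋃ k ∈ Finset.Icc 1 K, bin t k := fun y hy => by
      obtain ⟨k, h1, h2, h3⟩ := exists_mem_bin hK hy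
      exact mem_biUnion (Finset.mem_coe.2 (Finset.mem_Icc.2 ⟨h1, h2⟩)) h3
    refine IntegrableOn.mono_set ((integrableOn_finset_iUnion).2 fun k hk => ?_) hsub
    obtain ⟨h1, h2⟩ := Finset.mem_Icc.1 hk
    refine (hGl k h1 h2).congr_fun (fun y hy => ?_) (measurableSet_bin t h1)
    simp only [hgbin k h1 h2 y hy]
  have hfeas : Feasible K t q m g := by
    refine ⟨fun y => Finset.sum_nonneg fun k _ => indicator_nonneg (fun y _ => hG0 k y) y,
      fun y hy => Finset.sum_eq_zero fun k hk => indicator_of_notMem (fun h => ?_) _,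
      integrable_finsetSum _ fun k hk => ?_, fun k h1 h2 => ?_, fun k h1 h2 => ?_,
      fun k h1 h2 => ?_⟩
    · obtain ⟨h1, h2⟩ := Finset.mem_Icc.1 hk
      exact absurd hy (not_lt.2 (bin_subset_Ici ht h1 h2 h))
    · obtain ⟨h1, h2⟩ := Finset.mem_Icc.1 hk
      exact (integrable_indicator_iff (measurableSet_bin t h1)).2 (hGi k h1 h2)
    · rw [setIntegral_congr_fun (measurableSet_bin t h1) (hgbin k h1 h2)]
      by_cases h : 0 < q k
      · simp only [hG, h, if_true]
        exact (hcb k h1 h2 h).mass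
      · simp [hG, le_antisymm (not_lt.1 h) (hq k h1 h2)]
    · exact (hGm k h1 h2).congr_fun (fun y hy => by simp only [hgbin k h1 h2 y hy])
        (measurableSet_bin t h1)
    · rw [setIntegral_congr_fun (g := fun y => y * G k y) (measurableSet_bin t h1)
        fun y hy => by simp only [hgbin k h1 h2 y hy]]
      by_cases h : 0 < q k
      · simp only [hG, h, if_true]
        exact (hcb k h1 h2 h).mean
      · simp [hG, le_antisymm (not_lt.1 h) (hq k h1 h2)]
  refine ⟨g, hfeas, hgl, fun h hh hhl => ?_⟩
  -- Objective and constraints both split over the bins, so it suffices to compare bin by bin.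
  rw [setIntegral_Ici_eq_sum_bin ht hK le_rfl hgl, setIntegral_Ici_eq_sum_bin ht hK le_rfl hhl]
  refine Finset.sum_le_sum fun k hk => ?_
  obtain ⟨h1, h2⟩ := Finset.mem_Icc.1 hk
  rw [setIntegral_congr_fun (g := fun y => G k y * Real.log (G k y)) (measurableSet_bin t h1)
        fun y hy => by simp only [hgbin k h1 h2 y hy]]
  by_cases hpos : 0 < q k
  · simp only [hG, hpos, if_true]
    exact (hcb k h1 h2 hpos).le_integral_mul_log hh.nonneg hh.integrable.integrableOn
      (hh.integrable_mean k h1 h2) (hh.mass k h1 h2) (hh.mean k h1 h2)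
      (hhl.mono_set (bin_subset_Ici ht h1 h2))
  · have hq0 : q k = 0 := le_antisymm (not_lt.1 hpos) (hq k h1 h2)
    have hz : h =ᵐ[volume.restrict (bin t k)] 0 :=
      (integral_eq_zero_iff_of_nonneg hh.nonneg hh.integrable.integrableOn).1
        ((hh.mass k h1 h2).trans hq0)
    have hz' : ∫ y in bin t k, h y * Real.log (h y) = 0 :=
      integral_eq_zero_of_ae (hz.mono fun y hy => by simp [hy])
    rw [hz']
    simp [hG, hpos]

/-! ### Order statistics and the tabulation of a sample -/

lemma antitone_orderStat {n : ℕ} (x : Fin n → ℝ) : Antitone (orderStat x) := fun _ _ hij =>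
  Tuple.monotone_sort x (Fin.rev_le_rev.2 hij)

/-- The order statistics decrease, so the indices counted by `topCount` form an initial segment.
This identifies `topSum` at `n_k` with the sum of the observations above `t_k`. -/
lemma val_lt_topCount_iff (t : ℕ → ℝ) {n : ℕ} (x : Fin n → ℝ) (k : ℕ) (i : Fin n) :
    i.val < topCount t x k ↔ thr t k ≤ (orderStat x i : EReal) :=
  Fin.lt_card_filter_univ_iff_apply_of_imp (fun i => thr t k ≤ (orderStat x i : EReal))
    fun _ _ hij h => h.trans (EReal.coe_le_coe_iff.2 (antitone_orderStat x hij))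

lemma topCount_zero (t : ℕ → ℝ) {n : ℕ} (x : Fin n → ℝ) : topCount t x 0 = 0 := by
  simp [topCount, thr]

/-- The fraction of the sample that is at least `v`. -/
noncomputable def tailFreq {n : ℕ} (x : Fin n → ℝ) (v : ℝ) : ℝ :=
  ((Finset.univ.filter fun i : Fin n => v ≤ x i).card : ℝ) / n

lemma topCount_div (t : ℕ → ℝ) {n : ℕ} (x : Fin n → ℝ) {k : ℕ} (hk : 1 ≤ k) :
    (topCount t x k : ℝ) / n = tailFreq x (t k) := by
  have hk' : k ≠ 0 := by omega
  unfold tailFreq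
  congr 2
  simp only [topCount, thr, hk', if_false, EReal.coe_le_coe_iff, orderStat]
  exact Finset.card_equiv (Fin.revPerm.trans (Tuple.sort x)) (by simp)

lemma antitone_tailFreq {n : ℕ} (x : Fin n → ℝ) : Antitone (tailFreq x) := fun u v huv => by
  unfold tailFreq
  gcongr with i

lemma tailFreq_le_one {n : ℕ} (x : Fin n → ℝ) (v : ℝ) : tailFreq x v ≤ 1 := by
  refine div_le_one_of_le₀ ?_ (by positivity)
  exact_mod_cast (Finset.card_filter_le _ _).trans (by simp)

lemma topCount_mono {K : ℕ} {t : ℕ → ℝ} (ht : ∀ k, 2 ≤ k → k ≤ K → t k < t (k - 1)) {n : ℕ}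
    (x : Fin n → ℝ) {k : ℕ} (hk : k ≤ K) : topCount t x (k - 1) ≤ topCount t x k :=
  Finset.card_le_card (Finset.monotone_filter_right _ fun _ _ h =>
    (thr_le_thr ht (by omega) hk).trans h)

lemma qHat_nonneg {K : ℕ} {t : ℕ → ℝ} (ht : ∀ k, 2 ≤ k → k ≤ K → t k < t (k - 1)) {n : ℕ}
    (x : Fin n → ℝ) {k : ℕ} (hk : k ≤ K) : 0 ≤ qHat t x k :=
  div_nonneg (sub_nonneg.2 (by exact_mod_cast topCount_mono ht x hk)) (by positivity)

/-- Without ties between the sample and the thresholds, the mean of a nonempty bin lies in the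
interior of the bin. -/
lemma yHat_mem_interior {K : ℕ} {t : ℕ → ℝ} (ht : ∀ k, 2 ≤ k → k ≤ K → t k < t (k - 1)) {n : ℕ}
    {x : Fin n → ℝ} (hx : ∀ i k, x i ≠ t k) {k : ℕ} (hk : 1 ≤ k) (hkK : k ≤ K)
    (hq : 0 < qHat t x k) :
    t k < yHat t x k ∧ (2 ≤ k → yHat t x k < t (k - 1)) := by
  set T : ℕ → Finset (Fin n) := fun k =>
    Finset.univ.filter fun i : Fin n => thr t k ≤ (orderStat x i : EReal) with hT
  have hsum : ∀ k, topSum x (topCount t x k) = ∑ i ∈ T k, orderStat x i := fun k => by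
    simp only [topSum, hT, val_lt_topCount_iff]
  have hsub : T (k - 1) ⊆ T k := Finset.monotone_filter_right _ fun _ _ h =>
    (thr_le_thr ht (by omega) hkK).trans h
  have hcard : ((T k \ T (k - 1)).card : ℝ) = (topCount t x k : ℝ) - topCount t x (k - 1) := by
    rw [Finset.cast_card_sdiff hsub]
    rfl
  have hdiff : topSum x (topCount t x k) - topSum x (topCount t x (k - 1))
      = ∑ i ∈ T k \ T (k - 1), orderStat x i := by
    rw [hsum, hsum, ← Finset.sum_sdiff hsub]; ring
  have hpos : (0 : ℝ) < (T k \ T (k - 1)).card := by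
    rw [hcard]
    by_contra h
    exact absurd hq (not_lt.2 (div_nonpos_of_nonpos_of_nonneg (not_lt.1 h) (by positivity)))
  have hne : (T k \ T (k - 1)).Nonempty := Finset.card_pos.1 (by exact_mod_cast hpos)
  have hk0 : k ≠ 0 := by omega
  unfold yHat
  rw [hdiff, ← hcard, lt_div_iff₀ hpos]
  -- Bins are closed on the left, so strictness there needs the absence of ties; on the right it is
  -- automatic.
  constructor
  · have := Finset.sum_lt_sum_of_nonempty (f := fun _ => t k) (g := orderStat x) hne fun i hi => by
      have h1 := (Finset.mem_filter.1 (Finset.mem_sdiff.1 hi).1).2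
      simp only [thr, hk0, if_false, EReal.coe_le_coe_iff] at h1
      exact h1.lt_of_ne (hx _ _).symm
    simpa [mul_comm] using this
  · intro hk2
    have hk1 : k - 1 ≠ 0 := by omega
    rw [div_lt_iff₀ hpos]
    have := Finset.sum_lt_sum_of_nonempty (f := orderStat x) (g := fun _ => t (k - 1)) hne
      fun i hi => by
        have h1 := (Finset.mem_sdiff.1 hi).2
        simpa [hT, thr, hk1] using h1
    simpa [mul_comm] using this

/-- Without ties between the sample and the thresholds, the maximum entropy density exists; in
particular it satisfies the moment conditions. -/
theorem isMESolution_fHat {K : ℕ} {t : ℕ → ℝ} (hK : 1 ≤ K)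
    (ht : ∀ k, 2 ≤ k → k ≤ K → t k < t (k - 1)) {n : ℕ} {x : Fin n → ℝ}
    (hx : ∀ i k, x i ≠ t k) : IsMESolution K t (qHat t x) (yHat t x) (fHat K t x) := by
  have h := exists_isMESolution (q := qHat t x) (m := yHat t x) hK ht
    (fun k _ h2 => qHat_nonneg ht x h2)
    (fun k h1 h2 h3 => (yHat_mem_interior ht hx h1 h2 h3).1)
    (fun k h1 h2 h3 => (yHat_mem_interior ht hx (by omega) h2 h3).2 h1)
  unfold fHat meDensity
  rw [dif_pos h]
  exact h.choose_spec

/-! ### Tails and distribution function of the estimate -/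

section

variable {K : ℕ} {t : ℕ → ℝ} {n : ℕ} {x : Fin n → ℝ}

/-- The bin masses telescope down from `n_0 = 0`. -/
lemma setIntegral_Ici_fHat (ht : ∀ k, 2 ≤ k → k ≤ K → t k < t (k - 1))
    (hf : Feasible K t (qHat t x) (yHat t x) (fHat K t x)) {k : ℕ} (hk : 1 ≤ k) (hkK : k ≤ K) :
    ∫ y in Ici (t k), fHat K t x y = tailFreq x (t k) := by
  rw [setIntegral_Ici_eq_sum_bin ht hk hkK hf.integrable.integrableOn, ← topCount_div t x hk]
  have h1 : ∀ j ∈ Finset.Icc 1 k, ∫ y in bin t j, fHat K t x y = qHat t x j := fun j hj => by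
    obtain ⟨h1, h2⟩ := Finset.mem_Icc.1 hj
    exact hf.mass j h1 (h2.trans hkK)
  rw [Finset.sum_congr rfl h1]
  clear h1 hkK
  induction k, hk using Nat.le_induction with
  | base => simp [qHat, topCount_zero]
  | succ k hk ih =>
    rw [Finset.sum_Icc_succ_top (by omega), ih, qHat, Nat.add_sub_cancel]
    ring

/-- The total mass may be less than one: observations below `t_K` are not tabulated. -/
lemma integral_fHat (hK : 1 ≤ K) (ht : ∀ k, 2 ≤ k → k ≤ K → t k < t (k - 1))
    (hf : Feasible K t (qHat t x) (yHat t x) (fHat K t x)) :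
    ∫ y, fHat K t x y = tailFreq x (t K) := by
  rw [← setIntegral_Ici_fHat ht hf hK le_rfl]
  exact (setIntegral_eq_integral_of_forall_compl_eq_zero fun y hy =>
    hf.eq_zero y (not_le.1 hy)).symm

lemma setIntegral_Iio_fHat (hK : 1 ≤ K) (ht : ∀ k, 2 ≤ k → k ≤ K → t k < t (k - 1))
    (hf : Feasible K t (qHat t x) (yHat t x) (fHat K t x)) {k : ℕ} (hk : 1 ≤ k) (hkK : k ≤ K) :
    ∫ y in Iio (t k), fHat K t x y = tailFreq x (t K) - tailFreq x (t k) := by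
  rw [← integral_fHat hK ht hf, ← setIntegral_Ici_fHat ht hf hk hkK,
    ← integral_add_compl (measurableSet_Iio (a := t k)) hf.integrable, compl_Iio]
  ring

lemma setIntegral_fHat_mono (hf : Feasible K t (qHat t x) (yHat t x) (fHat K t x)) {A B : Set ℝ}
    (hAB : A ⊆ B) : ∫ y in A, fHat K t x y ≤ ∫ y in B, fHat K t x y :=
  setIntegral_mono_set hf.integrable.integrableOn (ae_of_all _ hf.nonneg) hAB.eventuallyLE

lemma monotone_FHat (hf : Feasible K t (qHat t x) (yHat t x) (fHat K t x)) :
    Monotone (FHat K t x) := fun _ _ h => setIntegral_fHat_mono hf (Iic_subset_Iic.2 h)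

lemma FHat_nonneg (hf : Feasible K t (qHat t x) (yHat t x) (fHat K t x)) (y : ℝ) :
    0 ≤ FHat K t x y := integral_nonneg hf.nonneg

lemma FHat_le_one (hK : 1 ≤ K) (ht : ∀ k, 2 ≤ k → k ≤ K → t k < t (k - 1))
    (hf : Feasible K t (qHat t x) (yHat t x) (fHat K t x)) (y : ℝ) : FHat K t x y ≤ 1 := by
  refine le_trans ?_ (tailFreq_le_one x (t K))
  rw [← integral_fHat hK ht hf]
  exact setIntegral_le_integral hf.integrable (ae_of_all _ hf.nonneg)

/-- If the bounded bins are short, then the estimated distribution function at `y` is at most the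
empirical one slightly to the right of `y`, or `y` lies in the unbounded bin. -/
lemma FHat_le (hK : 1 ≤ K) (ht : ∀ k, 2 ≤ k → k ≤ K → t k < t (k - 1))
    (hf : Feasible K t (qHat t x) (yHat t x) (fHat K t x)) {y v : ℝ}
    (hv : ∀ k, 2 ≤ k → k ≤ K → t (k - 1) - t k ≤ v - y) :
    FHat K t x y ≤ 1 - tailFreq x v ∨ t 1 ≤ y := by
  by_cases hy : t K ≤ y
  · obtain ⟨k, h1, h2, h3⟩ := exists_mem_bin hK hy
    obtain rfl | h4 := h1.eq_or_lt
    · right; rwa [bin_one] at h3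
    · left
      obtain ⟨j, rfl⟩ : ∃ j, k = j + 1 := ⟨k - 1, by omega⟩
      rw [bin_succ t (by omega)] at h3
      have h5 := hv (j + 1) (by omega) h2
      rw [Nat.add_sub_cancel] at h5
      have h6 : FHat K t x y ≤ ∫ z in Iio (t j), fHat K t x z :=
        setIntegral_fHat_mono hf fun z hz => lt_of_le_of_lt hz h3.2
      rw [setIntegral_Iio_fHat hK ht hf (by omega) (by omega)] at h6
      -- The upper end `t j` of the bin containing `y` exceeds `y` by at most the bin length, hence
      -- does not pass `v`.
      have h7 := antitone_tailFreq x (show t j ≤ v by linarith [h3.1])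
      linarith [tailFreq_le_one x (t K)]
  · left
    have : FHat K t x y = 0 := setIntegral_eq_zero_of_forall_eq_zero fun z hz =>
      hf.eq_zero z (lt_of_le_of_lt hz (not_le.1 hy))
    rw [this]
    linarith [tailFreq_le_one x v]

/-- If the bounded bins are short, then the estimated distribution function at `y` is bounded below
by the empirical one slightly to the left of `y`, unless `y` lies in the unbounded bin or below all
bins. -/
lemma le_FHat (hK : 1 ≤ K) (ht : ∀ k, 2 ≤ k → k ≤ K → t k < t (k - 1))
    (hf : Feasible K t (qHat t x) (yHat t x) (fHat K t x)) {y u : ℝ}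
    (hu : ∀ k, 2 ≤ k → k ≤ K → t (k - 1) - t k ≤ y - u) :
    tailFreq x (t K) - tailFreq x u ≤ FHat K t x y ∨
      tailFreq x (t K) - tailFreq x (t 1) ≤ FHat K t x y ∨ y < t K := by
  by_cases hy : t K ≤ y
  · obtain ⟨k, h1, h2, h3⟩ := exists_mem_bin hK hy
    have key : t k ≤ y → tailFreq x (t K) - tailFreq x (t k) ≤ FHat K t x y := fun hky => by
      rw [← setIntegral_Iio_fHat hK ht hf h1 h2]
      exact setIntegral_fHat_mono hf fun z hz => (le_of_lt hz).trans hky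
    obtain rfl | h4 := h1.eq_or_lt
    · rw [bin_one] at h3
      exact Or.inr (Or.inl (key h3))
    · left
      obtain ⟨j, rfl⟩ : ∃ j, k = j + 1 := ⟨k - 1, by omega⟩
      rw [bin_succ t (by omega)] at h3
      have h5 := hu (j + 1) (by omega) h2
      rw [Nat.add_sub_cancel] at h5
      have h7 := antitone_tailFreq x (show u ≤ t (j + 1) by linarith [h3.2])
      linarith [key h3.1]
  · exact Or.inr (Or.inr (not_le.1 hy))

end

/-! ### Distribution functions and their empirical counterparts -/

/-- A jump of the distribution function is the mass of an atom. -/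
lemma continuous_cdf (μ : Measure ℝ) [IsProbabilityMeasure μ] [NullSingletonClass μ] :
    Continuous (cdf μ) := by
  refine continuous_iff_continuousAt.2 fun a => ?_
  rw [(monotone_cdf μ).continuousAt_iff_leftLim_eq_rightLim, StieltjesFunction.rightLim_eq]
  have h := (cdf μ).measure_singleton a
  rw [measure_cdf, measure_singleton] at h
  exact le_antisymm ((monotone_cdf μ).leftLim_le le_rfl)
    (sub_nonpos.1 (ENNReal.ofReal_eq_zero.1 h.symm))

lemma measureReal_Ici_eq_one_sub_cdf (μ : Measure ℝ) [IsProbabilityMeasure μ]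
    [NullSingletonClass μ] (v : ℝ) : μ.real (Ici v) = 1 - cdf μ v := by
  have h : μ.real (Iio v) = μ.real (Iic v) := measureReal_congr Iio_ae_eq_Iic
  rw [cdf_eq_real, ← h, ← probReal_compl_eq_one_sub measurableSet_Iio, compl_Iio]

/-- Used in contrapositive form: a point with positive distribution function lies strictly above
`inf D`, so the last threshold eventually falls below it. -/
lemma cdf_eq_zero_of_le_einf {μ : Measure ℝ} [IsProbabilityMeasure μ] {f : ℝ → ℝ}
    (hμ : μ = volume.withDensity fun y => ENNReal.ofReal (f y)) {a : ℝ}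
    (ha : (a : EReal) ≤ einf (domain f)) : cdf μ a = 0 := by
  have h1 : ∀ y ∈ Iio a, f y ≤ 0 := fun y hy => by
    by_contra h
    exact absurd (ha.trans (iInf₂_le (f := fun (z : ℝ) (_ : z ∈ domain f) => (z : EReal)) y
      (not_le.1 h))) (not_le.2 (EReal.coe_lt_coe_iff.2 hy))
  have h2 : μ (Iio a) = 0 := by
    rw [hμ, withDensity_apply _ measurableSet_Iio,
      setLIntegral_congr_fun (g := fun _ => 0) measurableSet_Iio
        fun y hy => ENNReal.ofReal_eq_zero.2 (h1 y hy)]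
    simp
  have : NullSingletonClass μ := by rw [hμ]; infer_instance
  rw [cdf_eq_real, measureReal_def, ← measure_congr Iio_ae_eq_Iic, h2, ENNReal.toReal_zero]

lemma cdf_eq_one_of_esup_le {μ : Measure ℝ} [IsProbabilityMeasure μ] {f : ℝ → ℝ}
    (hμ : μ = volume.withDensity fun y => ENNReal.ofReal (f y)) {a : ℝ}
    (ha : esup (domain f) ≤ a) : cdf μ a = 1 := by
  have h1 : ∀ y ∈ Ioi a, f y ≤ 0 := fun y hy => by
    by_contra h
    exact absurd ((le_iSup₂ (f := fun (z : ℝ) (_ : z ∈ domain f) => (z : EReal)) y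
      (not_le.1 h)).trans ha) (not_le.2 (EReal.coe_lt_coe_iff.2 hy))
  have h2 : μ (Iic a)ᶜ = 0 := by
    rw [compl_Iic, hμ, withDensity_apply _ measurableSet_Ioi,
      setLIntegral_congr_fun (g := fun _ => 0) measurableSet_Ioi
        fun y hy => ENNReal.ofReal_eq_zero.2 (h1 y hy)]
    simp
  rw [cdf_eq_real, measureReal_def, (prob_compl_eq_zero_iff measurableSet_Iic).1 h2,
    ENNReal.toReal_one]

/-- The intermediate value theorem gives a real point, and continuity allows moving it to a rational
one, where the strong law will be available. -/
lemma exists_rat_cdf_mem_Ioo (μ : Measure ℝ) [IsProbabilityMeasure μ] [NullSingletonClass μ]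
    {a b : ℝ} (ha : 0 ≤ a) (hab : a < b) (hb : b ≤ 1) : ∃ v : ℚ, cdf μ v ∈ Ioo a b := by
  obtain ⟨c, hac, hcb⟩ := exists_between hab
  have h1 := ((tendsto_cdf_atBot μ).eventually_lt_const (ha.trans_lt hac)).exists
  have h2 := ((tendsto_cdf_atTop μ).eventually_const_lt (hcb.trans_le hb)).exists
  obtain ⟨y, hy⟩ := mem_range_of_exists_le_of_exists_ge (continuous_cdf μ)
    (h1.imp fun _ h => h.le) (h2.imp fun _ h => h.le)
  exact Rat.denseRange_cast.exists_mem_open (isOpen_Ioo.preimage (continuous_cdf μ))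
    ⟨y, show cdf μ y ∈ Ioo a b by rw [hy]; exact ⟨hac, hcb⟩⟩

/-- The strong law of large numbers for the empirical frequency of `[v, ∞)`. -/
lemma ae_tendsto_tailFreq {Ω : Type*} [MeasurableSpace Ω] {P : Measure Ω} [IsProbabilityMeasure P]
    {Y : ℕ → Ω → ℝ} (hm : ∀ i, Measurable (Y i)) (hind : iIndepFun Y P)
    (hid : ∀ i, P.map (Y i) = P.map (Y 0)) (v : ℝ) :
    ∀ᵐ ω ∂P, Tendsto (fun n : ℕ => tailFreq (fun i : Fin n => Y i ω) v) atTop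
      (𝓝 ((P.map (Y 0)).real (Ici v))) := by
  set φ : ℝ → ℝ := (Ici v).indicator fun _ => 1 with hφ
  have hφm : Measurable φ := measurable_const.indicator measurableSet_Ici
  have hint : Integrable (φ ∘ Y 0) P := by
    refine Integrable.of_bound ((hφm.comp (hm 0)).aestronglyMeasurable) 1 (ae_of_all _ fun ω => ?_)
    simp only [hφ, Function.comp_apply, indicator]
    split_ifs <;> simp
  have h := strong_law_ae_real (fun i => φ ∘ Y i) hint
    (fun i j hij => (hind.indepFun hij).comp hφm hφm)
    (fun i => (IdentDistrib.mk (hm i).aemeasurable (hm 0).aemeasurable (hid i)).comp hφm)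
  have hE : ∫ ω, φ (Y 0 ω) ∂P = (P.map (Y 0)).real (Ici v) := by
    rw [← integral_map (hm 0).aemeasurable hφm.aestronglyMeasurable, hφ]
    exact integral_indicator_one measurableSet_Ici
  simp only [Function.comp_apply, hE] at h
  filter_upwards [h] with ω hω
  refine hω.congr fun n => ?_
  simp only [tailFreq, hφ]
  congr 1
  rw [Finset.sum_range (fun i => (Ici v).indicator (fun _ => (1 : ℝ)) (Y i ω)), Finset.card_filter]
  push_cast
  exact Finset.sum_congr rfl fun i _ => by simp [indicator]

/-- Monotone functions that converge pointwise to a continuous function converge uniformly on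
compact sets. -/
lemma tendstoUniformlyOn_of_monotone {G : ℕ → ℝ → ℝ} {F : ℝ → ℝ}
    (hG : ∀ᶠ n in atTop, Monotone (G n)) (hF : Continuous F) (hFm : Monotone F)
    (hlim : ∀ y, Tendsto (fun n => G n y) atTop (𝓝 (F y))) {C : Set ℝ} (hC : IsCompact C) :
    TendstoUniformlyOn G F atTop C := by
  rw [← tendstoLocallyUniformlyOn_iff_tendstoUniformlyOn_of_compact hC,
    Metric.tendstoLocallyUniformlyOn_iff]
  intro ε hε y _
  obtain ⟨δ, hδ, h⟩ := Metric.continuousAt_iff.1 (hF.continuousAt (x := y)) (ε / 2) (half_pos hε)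
  have hl := h (x := y - δ / 2) (by rw [Real.dist_eq, abs_lt]; constructor <;> linarith)
  have hr := h (x := y + δ / 2) (by rw [Real.dist_eq, abs_lt]; constructor <;> linarith)
  rw [Real.dist_eq, abs_lt] at hl hr
  -- On this interval both monotone functions are controlled by their values at the two endpoints,
  -- where pointwise convergence applies.
  refine ⟨Icc (y - δ / 2) (y + δ / 2),
    mem_nhdsWithin_of_mem_nhds (Icc_mem_nhds (by linarith) (by linarith)), ?_⟩
  filter_upwards [hG, (hlim (y - δ / 2)).eventually_const_lt (show F y - ε / 2 < _ by linarith),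
    (hlim (y + δ / 2)).eventually_lt_const (show _ < F y + ε / 2 by linarith)] with n h1 h2 h3 z hz
  rw [Real.dist_eq, abs_lt]
  constructor <;>
    linarith [h1 hz.1, h1 hz.2, hFm hz.1, hFm hz.2]

/-! ### Consistency -/

section

variable {Ω : Type*} [MeasurableSpace Ω] {P : Measure Ω}
  {Y : ℕ → Ω → ℝ} {f : ℝ → ℝ} {K : ℕ → ℕ} {t : ℕ → ℕ → ℝ}

/-- There are countably many thresholds in all, and each is hit with probability zero because the
law has a density. -/
lemma Assumption.ae_forall_ne (hA : Assumption P Y f K t) :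
    ∀ᵐ ω ∂P, ∀ i n k, Y i ω ≠ t n k := by
  simp only [ae_all_iff]
  intro i n k
  have h : ∀ᵐ y ∂(P.map (Y i)), y ≠ t n k := by
    rw [hA.density i]
    exact compl_mem_ae_iff.2 (measure_singleton _)
  exact ae_of_ae_map (hA.measurable i).aemeasurable h

lemma Assumption.eventually_bin_length_le (hA : Assumption P Y f K t) {δ : ℝ} (hδ : 0 < δ) :
    ∀ᶠ n in atTop, ∀ k, 2 ≤ k → k ≤ K n → t n (k - 1) - t n k ≤ δ := by
  obtain ⟨c₁, c₂, r₁, r₂, -, -, hr₂, -, -, h⟩ := hA.bin_length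
  have hlim : Tendsto (fun n : ℕ => c₂ * (n : ℝ) ^ (-r₂)) atTop (𝓝 0) := by
    simpa using ((tendsto_rpow_neg_atTop hr₂).comp tendsto_natCast_atTop_atTop).const_mul c₂
  filter_upwards [hlim.eventually_le_const hδ, eventually_ge_atTop 1] with n h1 h2 k h3 h4
  exact (h n h2 k h3 h4).2.trans h1

/-- The estimated distribution functions converge pointwise whenever the empirical ones converge at
all rational points. -/
lemma Assumption.tendsto_FHat [IsProbabilityMeasure P] (hA : Assumption P Y f K t)
    {x : ∀ n : ℕ, Fin n → ℝ}     (hx : ∀ n i k, x n i ≠ t n k)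
    (hlim : ∀ v : ℚ, Tendsto (fun n => tailFreq (x n) v) atTop (𝓝 (1 - cdf (P.map (Y 0)) v)))
    (y : ℝ) :
    Tendsto (fun n => FHat (K n) (t n) (x n) y) atTop (𝓝 (cdf (P.map (Y 0)) y)) := by
  have hdens := hA.density 0
  set μ := P.map (Y 0) with hμ
  have : IsProbabilityMeasure μ := Measure.isProbabilityMeasure_map (hA.measurable 0).aemeasurable
  have : NullSingletonClass μ := by rw [hdens]; infer_instance
  rw [Metric.tendsto_nhds]
  intro ε hε
  -- The final estimates use at most four errors of size `η`; the cap at `1` keeps the windows `(0,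
  -- η)` and `(1 - η, 1)` inside `[0, 1]`.
  set η := min (ε / 4) 1 with hη
  have hη0 : 0 < η := lt_min (by linarith) one_pos
  have hη1 : η ≤ 1 := min_le_right _ _
  have hηε : 4 * η ≤ ε := by linarith [min_le_left (ε / 4) 1]
  -- Only mass `η` lies to the left of `y₀` and to the right of `z₀`, while eventually `t_K < y₀`
  -- and `z₀ < t_1`. These fixed points bound the untabulated mass and the top bin.
  obtain ⟨y₀, hy₀⟩ := exists_rat_cdf_mem_Ioo μ le_rfl hη0 hη1
  obtain ⟨z₀, hz₀⟩ := exists_rat_cdf_mem_Ioo μ (show 0 ≤ 1 - η by linarith)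
    (show 1 - η < 1 by linarith) le_rfl
  have hlow : ∀ᶠ n in atTop, t n (K n) < y₀ := by
    have h1 : einf (domain f) < ((y₀ : ℝ) : EReal) := by
      by_contra h
      exact hy₀.1.ne' (cdf_eq_zero_of_le_einf hdens (not_lt.1 h))
    filter_upwards [eventually_lt_of_limsup_lt (hA.cover_inf.trans_lt h1)] with n hn
    exact EReal.coe_lt_coe_iff.1 hn
  have hupp : ∀ᶠ n in atTop, (z₀ : ℝ) < t n 1 := by
    have h1 : ((z₀ : ℝ) : EReal) < esup (domain f) := by
      by_contra h
      exact hz₀.2.ne (cdf_eq_one_of_esup_le hdens (not_lt.1 h))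
    filter_upwards [eventually_lt_of_lt_liminf (h1.trans_le hA.cover_sup)] with n hn
    exact EReal.coe_lt_coe_iff.1 hn
  obtain ⟨δ, hδ, hcont⟩ := Metric.continuousAt_iff.1
    ((continuous_cdf μ).continuousAt (x := y)) η hη0
  obtain ⟨u, hu1, hu2⟩ := exists_rat_btwn (show y - δ < y by linarith)
  obtain ⟨v, hv1, hv2⟩ := exists_rat_btwn (show y < y + δ by linarith)
  have hu := hcont (x := u) (by rw [Real.dist_eq, abs_lt]; constructor <;> linarith)
  have hv := hcont (x := v) (by rw [Real.dist_eq, abs_lt]; constructor <;> linarith)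
  rw [Real.dist_eq, abs_lt] at hu hv
  have hnear : ∀ w : ℚ, ∀ᶠ n in atTop, |tailFreq (x n) w - (1 - cdf μ w)| < η := fun w =>
    Metric.tendsto_nhds.1 (hlim w) η hη0
  filter_upwards [hlow, hupp, hnear y₀, hnear z₀, hnear u, hnear v, eventually_ge_atTop 1,
    hA.eventually_bin_length_le (sub_pos.2 hu2), hA.eventually_bin_length_le (sub_pos.2 hv1)]
    with n h1 h2 hy hz hu' hv' hn h3 h4
  have ht := hA.thr_anti n hn
  have hK := hA.bins_pos n hn
  have hf := (isMESolution_fHat hK ht (hx n)).feasible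
  rw [abs_lt] at hy hz hu' hv'
  rw [Real.dist_eq, abs_lt]
  have hKy := antitone_tailFreq (x n) h1.le
  have h1z := antitone_tailFreq (x n) h2.le
  constructor
  · rcases le_FHat hK ht hf h3 with h | h | h
    · linarith [hy₀.2]
    · linarith [hy₀.2, cdf_le_one μ y, hz₀.1]
    · linarith [hy₀.2, FHat_nonneg hf y, monotone_cdf μ (h.trans h1).le]
  · rcases FHat_le hK ht hf h4 with h | h
    · linarith
    · linarith [FHat_le_one hK ht hf y, monotone_cdf μ (h2.le.trans h), hz₀.1]

end

end TabulatedME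

theorem corollary1 {Ω : Type*} [MeasurableSpace Ω] (P : Measure Ω) [IsProbabilityMeasure P]
    (Y : ℕ → Ω → ℝ) (f : ℝ → ℝ) (K : ℕ → ℕ) (t : ℕ → ℕ → ℝ)
    (hA : TabulatedME.Assumption P Y f K t)
    (hD : ⊥ < TabulatedME.einf (TabulatedME.domain f))
    (C : Set ℝ) (hC : IsCompact C) (hCD : C ⊆ TabulatedME.domain f) :
    ∀ᵐ ω ∂P, Tendsto
      (fun n : ℕ => ⨆ y ∈ C, ENNReal.ofReal
        |TabulatedME.FHat (K n) (t n) (fun i : Fin n => Y i ω) y - cdf (P.map (Y 0)) y|)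
      atTop (𝓝 0) := by
  -- Restricting to rational points leaves countably many exceptional null sets, although the
  -- thresholds vary with `n`.
  have hae : ∀ᵐ ω ∂P, ∀ v : ℚ, Tendsto
      (fun n : ℕ => TabulatedME.tailFreq (fun i : Fin n => Y i ω) v) atTop
      (𝓝 ((P.map (Y 0)).real (Ici (v : ℝ)))) :=
    ae_all_iff.2 fun v => TabulatedME.ae_tendsto_tailFreq hA.measurable hA.indep
      (fun i => (hA.density i).trans (hA.density 0).symm) v
  have : IsProbabilityMeasure (P.map (Y 0)) :=
    Measure.isProbabilityMeasure_map (hA.measurable 0).aemeasurable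
  have : NullSingletonClass (P.map (Y 0)) := by rw [hA.density 0]; infer_instance
  simp only [TabulatedME.measureReal_Ici_eq_one_sub_cdf] at hae
  filter_upwards [hae, hA.ae_forall_ne] with ω hω hne
  have hmono : ∀ᶠ n : ℕ in atTop,
      Monotone (TabulatedME.FHat (K n) (t n) fun i : Fin n => Y i ω) := by
    filter_upwards [eventually_ge_atTop 1] with n hn
    exact TabulatedME.monotone_FHat (TabulatedME.isMESolution_fHat (hA.bins_pos n hn)
      (hA.thr_anti n hn) fun i k => hne i n k).feasible
  have hunif := TabulatedME.tendstoUniformlyOn_of_monotone hmono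
    (TabulatedME.continuous_cdf _) (monotone_cdf _)
    (hA.tendsto_FHat (x := fun n i => Y i ω) (fun n i k => hne i n k) hω) hC
  rw [ENNReal.tendsto_nhds_zero]
  intro ε hε
  -- The value `⊤` is treated apart because its `toReal` is `0`, not a valid tolerance.
  obtain rfl | hε' := eq_or_ne ε ⊤
  · exact Eventually.of_forall fun _ => le_top
  filter_upwards [Metric.tendstoUniformlyOn_iff.1 hunif ε.toReal (ENNReal.toReal_pos hε.ne' hε')]
    with n hn
  refine iSup₂_le fun y hy => ?_
  rw [← ENNReal.ofReal_toReal hε']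
  refine ENNReal.ofReal_le_ofReal ?_
  rw [abs_sub_comm]
  exact (hn y hy).le
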